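/- Let $X$ be a smooth projective (integral) variety over a field $k$, and suppose $\mathrm{Pic}(X)=\mathbb Z\cdot A$ for an ample effective Cartier divisor $A$, i.e. every line bundle on $X$ is isomorphic to $\mathcal O_X(nA)$ for a unique $n\in\mathbb Z$. Let $\Lambda_0$ be a line bundle on $X$ and $\mathcal E$ a vector bundle of rank $r$ on $X$, and write $\det\mathcal E\simeq\mathcal O_X(dA)$ and $\Lambda_0\simeq\mathcal O_X(d_0A)$ with $d,d_0\in\mathbb Z$. A hierarchical filtration of $\mathcal E$ of length $h\ge 0$ normalized by $\Lambda_0$ is a chain of subsheaves $\mathcal E_0\subset\mathcal E_1\subset\cdots\subset\mathcal E_h=\mathcal E$ such that every $\mathcal E_i$ is a vector bundle of rank $r$, every quotient $\mathcal E_i/\mathcal E_{i-1}$ ($1\le i\le h$) is a torsion sheaf, $\det\mathcal E_0\simeq\Lambda_0$, and there are nonzero effective Cartier divisors $D_1,\dots,D_h$ (the determinant increments) with $\det\mathcal E_i\simeq\det\mathcal E_{i-1}\otimes\mathcal O_X(D_i)$ for $1\le i\le h$. The hierarchical depth $h_{\Lambda_0}(\mathcal E)$ is the largest length of such a filtration,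 and $-\infty$ if there is none. Then: 1. every hierarchical filtration of $\mathcal E$ normalized by $\Lambda_0$ has length $h\le d-d_0$; thus $h_{\Lambda_0}(\mathcal E)\le d-d_0$, and in particular $h_{\Lambda_0}(\mathcal E)\le d$ when $\Lambda_0\simeq\mathcal O_X$; 2. a hierarchical filtration of $\mathcal E$ normalized by $\Lambda_0$ with determinant increments $D_1,\dots,D_h$ has length $h=d-d_0$ if and only if every $D_i$ is linearly equivalent to $A$; consequently $h_{\Lambda_0}(\mathcal E)=d-d_0$ if and only if there is a hierarchical filtration of $\mathcal E$ normalized by $\Lambda_0$ all of whose determinant increments are linearly equivalent to $A$. -/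

import Mathlib

open CategoryTheory Opposite TopologicalSpace AlgebraicGeometry

universe u

noncomputable section

namespace HierFilt

section ExteriorPower
universe v₁ u₁
variable {C : Type u₁} [Category.{v₁} C] {R : Cᵒᵖ ⥤ CommRingCat.{u}}

lemma restrict_update (r : ℕ) (M : PresheafOfModules.{u} (R ⋙ forget₂ CommRingCat RingCat))
    {U V : Cᵒᵖ} (f : U ⟶ V) [DecidableEq (Fin r)] (m : Fin r → M.obj U) (i : Fin r)
    (z : M.obj U) :
    (fun j ↦ (M.map f (Function.update m i z j) : M.obj V)) =
      Function.update (fun j ↦ (M.map f (m j) : M.obj V)) i (M.map f z) := by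
  ext j
  by_cases hj : j = i
  · subst hj; simp
  · simp [hj]

/-- The restriction map `x₁ ∧ ⋯ ∧ xᵣ ↦ x₁|_V ∧ ⋯ ∧ xᵣ|_V` of exterior powers. -/
def exteriorPresheafMap (r : ℕ) (M : PresheafOfModules.{u} (R ⋙ forget₂ CommRingCat RingCat))
    {U V : Cᵒᵖ} (f : U ⟶ V) :
    ModuleCat.exteriorPower (R := R.obj U) (M.obj U) r ⟶
      (ModuleCat.restrictScalars (R.map f).hom).obj
        (ModuleCat.exteriorPower (R := R.obj V) (M.obj V) r) :=
  ModuleCat.exteriorPower.desc (R := R.obj U)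
    (N := (ModuleCat.restrictScalars (R.map f).hom).obj
      (ModuleCat.exteriorPower (R := R.obj V) (M.obj V) r))
    { toFun := fun x ↦ exteriorPower.ιMulti (R.obj V) (M := M.obj V) r fun i ↦ M.map f (x i)
      map_update_add' := by
        intro _ m i x y
        have h := restrict_update r M f m i
        refine (congrArg _ (h (x + y))).trans ?_
        rw [map_add]
        refine (AlternatingMap.map_update_add (exteriorPower.ιMulti (R.obj V) (M := M.obj V) r)
          (fun j ↦ M.map f (m j)) i (M.map f x) (M.map f y)).trans ?_
        exact congrArg₂ (· + ·) (congrArg _ (h x)).symm (congrArg _ (h y)).symm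
      map_update_smul' := by
        intro _ m i c x
        have h := restrict_update r M f m i
        refine (congrArg _ (h (c • x))).trans ?_
        rw [show M.map f (c • x) = (R.map f).hom c • M.map f x from M.map_smul f c x]
        refine (AlternatingMap.map_update_smul (exteriorPower.ιMulti (R.obj V) (M := M.obj V) r)
          (fun j ↦ M.map f (m j)) i ((R.map f).hom c) (M.map f x)).trans ?_
        exact congrArg (fun t ↦ (R.map f).hom c • t) (congrArg _ (h x)).symm
      map_eq_zero_of_eq' := by
        intro v i j h hij
        exact AlternatingMap.map_eq_zero_of_eq (exteriorPower.ιMulti (R.obj V) (M := M.obj V) r)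
          _ (congrArg (M.map f) h) hij }

lemma exteriorPresheafMap_mk (r : ℕ)
    (M : PresheafOfModules.{u} (R ⋙ forget₂ CommRingCat RingCat))
    {U V : Cᵒᵖ} (f : U ⟶ V) (x : Fin r → M.obj U) :
    exteriorPresheafMap r M f (exteriorPower.ιMulti (R.obj U) (M := M.obj U) r x) =
      exteriorPower.ιMulti (R.obj V) (M := M.obj V) r fun i ↦ M.map f (x i) :=
  ModuleCat.exteriorPower.desc_mk _ _

/-- The presheaf of modules `U ↦ ⋀ʳ M(U)`. -/
def exteriorPresheaf (r : ℕ) (M : PresheafOfModules.{u} (R ⋙ forget₂ CommRingCat RingCat)) :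
    PresheafOfModules.{u} (R ⋙ forget₂ CommRingCat RingCat) where
  obj U := ModuleCat.exteriorPower (R := R.obj U) (M.obj U) r
  map f := exteriorPresheafMap r M f
  map_id U := by
    refine ModuleCat.exteriorPower.hom_ext (R := R.obj U) (ModuleCat.AlternatingMap.ext ?_)
    intro x
    refine (exteriorPresheafMap_mk r M (𝟙 U) x).trans ?_
    simp
    rfl
  map_comp {U V W} f g := by
    refine ModuleCat.exteriorPower.hom_ext (R := R.obj U) (ModuleCat.AlternatingMap.ext ?_)
    intro x
    refine (exteriorPresheafMap_mk r M (f ≫ g) x).trans ?_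
    refine Eq.trans ?_ (congrArg (exteriorPresheafMap r M g)
      (exteriorPresheafMap_mk r M f x)).symm
    refine Eq.trans ?_ (exteriorPresheafMap_mk r M g _).symm
    exact congrArg _ (funext fun i ↦ M.map_comp_apply f g (x i))

/-- The morphism induced on exterior powers by a morphism of presheaves of modules. -/
def exteriorPresheafHom (r : ℕ) {M N : PresheafOfModules.{u} (R ⋙ forget₂ CommRingCat RingCat)}
    (φ : M ⟶ N) : exteriorPresheaf r M ⟶ exteriorPresheaf r N where
  app U := ModuleCat.exteriorPower.map (R := R.obj U) (M := M.obj U) (N := N.obj U) (φ.app U) r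
  naturality {U V} f := by
    refine ModuleCat.exteriorPower.hom_ext (R := R.obj U) (ModuleCat.AlternatingMap.ext ?_)
    intro x
    refine (congrArg (ModuleCat.exteriorPower.map (R := R.obj V) (M := M.obj V) (N := N.obj V)
      (φ.app V) r) (exteriorPresheafMap_mk r M f x)).trans ?_
    refine (ModuleCat.exteriorPower.map_mk (R := R.obj V) (M := M.obj V) (N := N.obj V)
      (φ.app V) _).trans ?_
    refine Eq.trans ?_ (congrArg (exteriorPresheafMap r N f)
      (ModuleCat.exteriorPower.map_mk (R := R.obj U) (M := M.obj U) (N := N.obj U)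
        (φ.app U) x)).symm
    refine Eq.trans ?_ (exteriorPresheafMap_mk r N f _).symm
    exact congrArg _ (funext fun i ↦ PresheafOfModules.naturality_apply φ f (x i))

/-- The `r`-th exterior power as a functor on presheaves of modules. -/
def exteriorFunctor (r : ℕ) : PresheafOfModules.{u} (R ⋙ forget₂ CommRingCat RingCat) ⥤
    PresheafOfModules.{u} (R ⋙ forget₂ CommRingCat RingCat) where
  obj M := exteriorPresheaf r M
  map φ := exteriorPresheafHom r φ
  map_id M := by
    ext1 U
    exact (ModuleCat.exteriorPower.functor (R.obj U) r).map_id (M.obj U)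
  map_comp {L M N} φ ψ := by
    ext1 U
    exact (ModuleCat.exteriorPower.functor (R.obj U) r).map_comp
      (X := L.obj U) (Y := M.obj U) (Z := N.obj U) (φ.app U) (ψ.app U)

end ExteriorPower

variable (X : Scheme.{u})

/-- The sheaf of `𝒪_X`-modules associated to a presheaf of `𝒪_X`-modules. -/
def sheafify : X.PresheafOfModules ⥤ X.Modules :=
  PresheafOfModules.sheafification (𝟙 X.ringCatSheaf.obj)

/-- The determinant `⋀ʳ E` of a sheaf of modules `E` of rank `r`: the sheaf associated to
`U ↦ ⋀ʳ E(U)`. For a vector bundle it is a line bundle, hence equal to its double dual. -/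
def det (r : ℕ) : X.Modules ⥤ X.Modules :=
  Scheme.Modules.toPresheafOfModules X ⋙ exteriorFunctor (R := X.presheaf) r ⋙ sheafify X

variable {X}

/-- The tensor product `L ⊗ M`: the sheaf associated to `U ↦ L(U) ⊗ M(U)`. -/
def tensor (L M : X.Modules) : X.Modules :=
  (sheafify X).obj (PresheafOfModules.Monoidal.tensorObj (R := X.presheaf) L.val M.val)

/-- `E` is a vector bundle of rank `r`: it is locally isomorphic to `𝒪ʳ`. -/
def IsVectorBundle (r : ℕ) (E : X.Modules) : Prop :=
  ∀ x : X, ∃ U : X.Opens, x ∈ U ∧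
    Nonempty (E.restrict U.ι ≅
      (SheafOfModules.free (R := U.toScheme.ringCatSheaf) (ULift.{u} (Fin r)) : U.toScheme.Modules))

/-- A line bundle is a vector bundle of rank one. -/
def IsLineBundle (L : X.Modules) : Prop := IsVectorBundle 1 L

variable (X) in
/-- The structure sheaf as a module over itself. -/
def structureSheaf : X.Modules := SheafOfModules.unit X.ringCatSheaf

variable [IsIntegral X]

variable (X) in
/-- The sections over `U` of the constant sheaf of rational functions on an integral scheme: the
function field if `U` is nonempty (i.e. contains the generic point), and zero if `U` is empty. -/
def RatSections (U : X.Opens) : Type u := PLift (genericPoint X ∈ U) → X.functionField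

instance (U : X.Opens) : CommRing (RatSections X U) := inferInstanceAs (CommRing (_ → _))

instance (U : X.Opens) : Algebra Γ(X, U) (RatSections X U) :=
  RingHom.toAlgebra (RingHom.pi fun h ↦ (X.presheaf.germ U (genericPoint X) h.down).hom)

lemma ratSections_smul_apply (U : X.Opens) (a : Γ(X, U)) (s : RatSections X U)
    (h : PLift (genericPoint X ∈ U)) :
    (a • s) h = X.presheaf.germ U (genericPoint X) h.down a * s h := rfl

/-- Restriction of rational sections. -/
def RatSections.res {U V : X.Opens} (i : V ≤ U) : RatSections X U →+ RatSections X V where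
  toFun s h := s ⟨i h.down⟩
  map_zero' := rfl
  map_add' _ _ := rfl

variable (X) in
/-- The image of the units of the local ring at `x` in the units of the function field. -/
def unitGerms (x : X) : Subgroup X.functionFieldˣ :=
  (Units.map (algebraMap (X.presheaf.stalk x) X.functionField).toMonoidHom).range

variable (X) in
/-- The group of global sections of the sheaf `𝒦ˣ / 𝒪ˣ`. Such a section is a family of germs
`D x ∈ K(X)ˣ / 𝒪_{X,x}ˣ` which locally is given by one rational function, and the group is
written additively. -/
def cartierDivisors : AddSubgroup (∀ x : X, Additive (X.functionFieldˣ ⧸ unitGerms X x)) where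
  carrier := {D | ∀ x, ∃ U : X.Opens, x ∈ U ∧ ∃ g : X.functionFieldˣ, ∀ y ∈ U,
    D y = Additive.ofMul (QuotientGroup.mk g)}
  zero_mem' x := ⟨⊤, trivial, 1, fun _ _ ↦ rfl⟩
  add_mem' {D D'} hD hD' x := by
    obtain ⟨U, hxU, g, hg⟩ := hD x
    obtain ⟨V, hxV, g', hg'⟩ := hD' x
    refine ⟨U ⊓ V, ⟨hxU, hxV⟩, g * g', fun y hy ↦ ?_⟩
    rw [Pi.add_apply, hg y hy.1, hg' y hy.2]
    rfl
  neg_mem' {D} hD x := by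
    obtain ⟨U, hxU, g, hg⟩ := hD x
    refine ⟨U, hxU, g⁻¹, fun y hy ↦ ?_⟩
    rw [Pi.neg_apply, hg y hy]
    rfl

variable (X) in
/-- A Cartier divisor on an integral scheme. -/
def CartierDivisor : Type u := cartierDivisors X

instance : AddCommGroup (CartierDivisor X) := inferInstanceAs (AddCommGroup (cartierDivisors X))

namespace CartierDivisor

variable (D D' : CartierDivisor X)

/-- `g` is a local equation of `D` at `x`. -/
def IsLocalEq (x : X) (g : X.functionFieldˣ) : Prop :=
  D.1 x = Additive.ofMul (QuotientGroup.mk g)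

/-- `D` is effective: its local equations are regular. -/
def IsEffective : Prop :=
  ∀ (x : X) (g : X.functionFieldˣ), D.IsLocalEq x g →
    (g : X.functionField) ∈ (algebraMap (X.presheaf.stalk x) X.functionField).range

/-- The principal divisor of a nonzero rational function. -/
def principal (f : X.functionFieldˣ) : CartierDivisor X :=
  ⟨fun _ ↦ Additive.ofMul (QuotientGroup.mk f), fun _ ↦ ⟨⊤, trivial, f, fun _ _ ↦ rfl⟩⟩

/-- Linear equivalence `D ∼ D'`. -/
def LinearlyEquivalent : Prop := ∃ f : X.functionFieldˣ, D - D' = principal f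

/-- The support of `D`: the points at which `1` is not a local equation. -/
def support : Set X := {x | D.1 x ≠ 0}

/-- `D` is ample: `X` is quasi-compact and every point `x` lies in an affine open set of the form
`X_s`, for a global section `s` of `𝒪_X(nD)` with `n ≥ 1`. A nonzero `s` is the same as
an effective divisor `B ∼ nD` (its divisor of zeros) up to units, and `X_s = X ∖ Supp B`. -/
def IsAmple : Prop :=
  CompactSpace X ∧ ∀ x : X, ∃ n : ℕ, 0 < n ∧ ∃ B : CartierDivisor X, B.IsEffective ∧
    LinearlyEquivalent B (n • D) ∧ x ∉ B.support ∧
    ∃ U : X.Opens, (U : Set X) = (B.support)ᶜ ∧ IsAffineOpen U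

/-- The sections of `𝒪_X(D)` over `U`: the rational functions `s` such that `s g` is regular at
each `x ∈ U`, where `g` is a local equation of `D` at `x`. -/
def sections (U : X.Opens) : Submodule Γ(X, U) (RatSections X U) where
  carrier := {s | ∀ (h : genericPoint X ∈ U), ∀ x ∈ U, ∀ g : X.functionFieldˣ, D.IsLocalEq x g →
    s ⟨h⟩ * g ∈ (algebraMap (X.presheaf.stalk x) X.functionField).range}
  zero_mem' h x _ g _ := by
    rw [show (0 : RatSections X U) ⟨h⟩ = 0 from rfl, zero_mul]
    exact zero_mem _
  add_mem' {s t} hs ht h x hx g hg := by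
    rw [show (s + t) ⟨h⟩ = s ⟨h⟩ + t ⟨h⟩ from rfl, add_mul]
    exact add_mem (hs h x hx g hg) (ht h x hx g hg)
  smul_mem' a s hs h x hx g hg := by
    have : Nonempty U := ⟨⟨x, hx⟩⟩
    rw [ratSections_smul_apply, mul_assoc]
    refine mul_mem ⟨X.presheaf.germ U x hx a, ?_⟩ (hs h x hx g hg)
    exact Scheme.algebraMap_germ_eq_germToFunctionField X hx a

/-- Restriction of sections of `𝒪_X(D)`. -/
def resSections {U V : X.Opens} (i : V ≤ U) : D.sections U →+ D.sections V :=
  ((RatSections.res i).comp (D.sections U).toAddSubgroup.subtype).codRestrict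
    (D.sections V).toAddSubgroup fun s h x hx ↦ s.2 (i h) x (i hx)

/-- `𝒪_X(D)` as a presheaf of abelian groups. -/
def presheafAb : TopCat.Presheaf Ab.{u} X where
  obj U := AddCommGrpCat.of (D.sections U.unop)
  map f := AddCommGrpCat.ofHom (D.resSections f.unop.le)

instance (U : X.Opensᵒᵖ) : Module (X.ringCatSheaf.obj.obj U) (D.presheafAb.obj U) :=
  inferInstanceAs (Module Γ(X, U.unop) (D.sections U.unop))

/-- `𝒪_X(D)` as a presheaf of modules. -/
def presheaf : X.PresheafOfModules :=
  PresheafOfModules.ofPresheaf D.presheafAb (by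
    intro U V f a s
    refine Subtype.ext (funext fun h ↦ ?_)
    change X.presheaf.germ U.unop (genericPoint X) _ a * s.1 _ =
      X.presheaf.germ V.unop (genericPoint X) _ (X.presheaf.map f a) * s.1 _
    congr 1
    exact (X.presheaf.germ_res_apply f.unop _ h.down a).symm)

lemma isSheaf_presheafAb : D.presheafAb.IsSheaf := by
  rw [TopCat.Presheaf.isSheaf_iff_isSheafUniqueGluing]
  intro ι U sf hsf
  have key : ∀ (i : ι) (hi : genericPoint X ∈ U i) (j : ι) (hj : genericPoint X ∈ U j),
      (sf i).1 ⟨hi⟩ = (sf j).1 ⟨hj⟩ := by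
    intro i hi j hj
    have := congrArg (fun t ↦ t.1 ⟨⟨hi, hj⟩⟩) (hsf i j)
    exact this
  have hmem : ∀ h : genericPoint X ∈ iSup U, ∃ i, genericPoint X ∈ U i := fun h ↦ by
    simpa using h
  classical
  let c : RatSections X (iSup U) := fun h ↦
    (sf (hmem h.down).choose).1 ⟨(hmem h.down).choose_spec⟩
  have hc : ∀ i (hi : genericPoint X ∈ U i) h, c h = (sf i).1 ⟨hi⟩ := fun i hi h ↦ key _ _ _ _
  refine ⟨⟨c, ?_⟩, ?_, ?_⟩
  · intro h x hx g hg
    obtain ⟨i, hi⟩ : ∃ i, x ∈ U i := by simpa using hx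
    have hη : genericPoint X ∈ U i :=
      ((genericPoint_spec X).mem_open_set_iff (U i).isOpen).mpr ⟨x, trivial, hi⟩
    rw [hc i hη ⟨h⟩]
    exact (sf i).2 hη x hi g hg
  · intro i
    refine Subtype.ext (funext fun h ↦ ?_)
    exact hc i h.down ⟨Opens.mem_iSup.mpr ⟨i, h.down⟩⟩
  · intro t ht
    refine Subtype.ext (funext fun h ↦ ?_)
    obtain ⟨i, hi⟩ := hmem h.down
    refine Eq.trans ?_ (hc i hi h).symm
    exact congrArg (fun t ↦ t.1 ⟨hi⟩) (ht i)

/-- The sheaf of modules `𝒪_X(D)`. -/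
def sheaf : X.Modules where
  val := D.presheaf
  isSheaf := D.isSheaf_presheafAb

end CartierDivisor

attribute [local instance] MvPolynomial.gradedAlgebra

/-- Projective `n`-space over a field `k`, as `Proj k[x₀, …, xₙ]`. -/
def projectiveSpace (k : Type u) [Field k] (n : ℕ) : Scheme.{u} :=
  Proj (MvPolynomial.homogeneousSubmodule (Fin (n + 1)) k)

/-- The structure morphism of projective space. -/
def projectiveSpaceToSpec (k : Type u) [Field k] (n : ℕ) :
    projectiveSpace k n ⟶ Spec (.of k) :=
  Proj.toSpecZero (MvPolynomial.homogeneousSubmodule (Fin (n + 1)) k) ≫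
    Spec.map (CommRingCat.ofHom
      (algebraMap k (MvPolynomial.homogeneousSubmodule (Fin (n + 1)) k 0)))

/-- A `k`-scheme is projective if it is a closed subscheme of a projective space over `k`. -/
def IsProjective {k : Type u} [Field k] {X : Scheme.{u}} (f : X ⟶ Spec (.of k)) : Prop :=
  ∃ (n : ℕ) (i : X ⟶ projectiveSpace k n), IsClosedImmersion i ∧ i ≫ projectiveSpaceToSpec k n = f

/-- A hierarchical filtration `E₀ ⊂ E₁ ⊂ ⋯ ⊂ E_h = E` of length `h`, normalized by `Λ₀`, of a
vector bundle `E` of rank `r` on an integral scheme `X`. -/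
structure HierarchicalFiltration (r : ℕ) (Λ₀ E : X.Modules) where
  /-- the length `h` -/
  length : ℕ
  /-- the subsheaf `Eᵢ` of `E` -/
  step : Fin (length + 1) → Subobject E
  step_last : step (Fin.last length) = ⊤
  step_le (i : Fin length) : step i.castSucc ≤ step i.succ
  isVectorBundle (i : Fin (length + 1)) : IsVectorBundle r (step i : X.Modules)
  /-- each quotient `Eᵢ₊₁ / Eᵢ` is a torsion sheaf, i.e. its stalk at the generic point is zero -/
  isTorsion (i : Fin length) : Subsingleton
    ((Limits.cokernel (Subobject.ofLE _ _ (step_le i))).presheaf.stalk (genericPoint X))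
  /-- the determinant increments -/
  incr : Fin length → CartierDivisor X
  incr_effective (i : Fin length) : (incr i).IsEffective
  incr_ne_zero (i : Fin length) : incr i ≠ 0
  det_succ (i : Fin length) : Nonempty ((det X r).obj (step i.succ : X.Modules) ≅
    tensor ((det X r).obj (step i.castSucc : X.Modules)) (incr i).sheaf)
  det_zero : Nonempty ((det X r).obj (step 0 : X.Modules) ≅ Λ₀)

/-- The hierarchical depth of `E` with respect to `Λ₀`: the largest length of a hierarchical
filtration of `E` normalized by `Λ₀`, and `-∞` (the supremum `⊥` of the empty family) if there
is none. -/
def hierarchicalDepth (r : ℕ) (Λ₀ E : X.Modules) : EReal :=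
  ⨆ F : HierarchicalFiltration r Λ₀ E, ((F.length : ℝ) : EReal)

end HierFilt

end

/-!
The theorem is a degree count. By the hypothesis on `Pic X`, every increment `Dᵢ` of a hierarchical
filtration satisfies `𝒪_X(Dᵢ) ≅ 𝒪_X(nᵢ A)` for a unique integer `nᵢ`, and the relations
`det Eᵢ ≅ det Eᵢ₋₁ ⊗ 𝒪_X(Dᵢ)` give `det E ≅ 𝒪_X((d₀ + ∑ nᵢ) A)`, so that `∑ nᵢ = d - d₀`
by uniqueness (`HierarchicalFiltration.nonempty_det_top_iso`). All `nᵢ` are at least `1`, whence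
`h ≤ ∑ nᵢ = d - d₀`, with equality exactly when every `nᵢ` is `1`, i.e. when `Dᵢ ∼ A`.

Positivity of `nᵢ` is the geometric input (`CartierDivisor.pos_of_linearlyEquivalent_zsmul`). If
`D` is effective and `D ∼ -m A` with `m ≥ 0`, then `D + m A` is an effective principal divisor,
that is, the divisor of a global function. A projective integral scheme is universally closed over
the field, so its ring of global functions is a field and this divisor is zero; two effective
divisors with sum zero vanish, hence `D = 0`.

The dictionary between divisors and line bundles is proved from the description of `𝒪_X(D)` inside
the rational functions: where `D` has the equation `g`, the sheaf `𝒪_X(D)` is free on `g⁻¹`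
(`CartierDivisor.bijective_smul_gen`). This makes `𝒪_X(D)` a line bundle, makes the multiplication
map `𝒪_X(D) ⊗ 𝒪_X(D') → 𝒪_X(D + D')` bijective locally, hence an isomorphism after
sheafification (`CartierDivisor.nonempty_tensor_iso`), and shows that each morphism
`𝒪_X(D) → 𝒪_X(D')` is multiplication by a rational function, so that isomorphic sheaves come from
linearly equivalent divisors (`CartierDivisor.linearlyEquivalent_iff_nonempty_iso`).
-/

noncomputable section

namespace HierFilt

variable {X : Scheme.{u}} [IsIntegral X]

/-! ### Rational functions that are regular on an open set -/

lemma genericPoint_mem {U : X.Opens} {x : X} (hx : x ∈ U) : genericPoint X ∈ U :=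
  ((genericPoint_spec X).mem_open_set_iff U.isOpen).mpr ⟨x, trivial, hx⟩

lemma subsingleton_ratSections {U : X.Opens} (h : genericPoint X ∉ U) :
    Subsingleton (RatSections X U) :=
  ⟨fun _ _ ↦ funext fun h' ↦ (h h'.down).elim⟩

lemma eq_bot_of_genericPoint_notMem {U : X.Opens} (h : genericPoint X ∉ U) : U = ⊥ := by
  ext x
  exact ⟨fun hx ↦ h (genericPoint_mem hx), fun hx ↦ hx.elim⟩

lemma subsingleton_sections_of_genericPoint_notMem {U : X.Opens} (h : genericPoint X ∉ U) :
    Subsingleton Γ(X, U) := by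
  obtain rfl := eq_bot_of_genericPoint_notMem h
  infer_instance

lemma algebraMap_germ {U : X.Opens} {x : X} (hx : x ∈ U) (a : Γ(X, U)) :
    algebraMap (X.presheaf.stalk x) X.functionField (X.presheaf.germ U x hx a) =
      X.presheaf.germ U (genericPoint X) (genericPoint_mem hx) a := by
  have : Nonempty U := ⟨⟨x, hx⟩⟩
  exact Scheme.algebraMap_germ_eq_germToFunctionField X hx a

lemma algebraMap_stalk_injective (x : X) :
    Function.Injective (algebraMap (X.presheaf.stalk x) X.functionField) :=
  IsFractionRing.injective _ _

/-- A rational function which is regular at every point of a nonempty open set `U` comes from a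
section of the structure sheaf over `U`. -/
lemma exists_germ_eq_of_forall_mem_range {U : X.Opens} (hU : genericPoint X ∈ U)
    (f : X.functionField)
    (hf : ∀ x ∈ U, f ∈ (algebraMap (X.presheaf.stalk x) X.functionField).range) :
    ∃ a : Γ(X, U), X.presheaf.germ U (genericPoint X) hU a = f := by
  have loc (x : U) : ∃ (V : X.Opens) (hV : x.1 ∈ V) (_ : V ≤ U) (a : Γ(X, V)),
      X.presheaf.germ V (genericPoint X) (genericPoint_mem hV) a = f := by
    obtain ⟨t, ht⟩ := hf x.1 x.2
    obtain ⟨V, hV, a, rfl⟩ := X.presheaf.exists_germ_eq t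
    refine ⟨V ⊓ U, ⟨hV, x.2⟩, inf_le_right, X.presheaf.map (homOfLE inf_le_left).op a, ?_⟩
    rw [← ht, algebraMap_germ hV]
    exact X.presheaf.germ_res_apply (homOfLE inf_le_left) _ _ a
  choose V hV hVU a ha using loc
  have compat : TopCat.Presheaf.IsCompatible X.presheaf V a := by
    intro i j
    by_cases h : genericPoint X ∈ V i ⊓ V j
    · apply germ_injective_of_isIntegral X _ h
      rw [X.presheaf.germ_res_apply, X.presheaf.germ_res_apply, ha, ha]
    · have := subsingleton_sections_of_genericPoint_notMem h
      exact Subsingleton.elim (α := Γ(X, V i ⊓ V j)) _ _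
  obtain ⟨s, hs, -⟩ := X.sheaf.existsUnique_gluing' V U (fun i ↦ homOfLE (hVU i))
    (fun x hx ↦ Opens.mem_iSup.mpr ⟨⟨x, hx⟩, hV _⟩) a compat
  refine ⟨s, ?_⟩
  rw [← ha ⟨_, hU⟩, ← hs ⟨_, hU⟩]
  exact (X.presheaf.germ_res_apply (homOfLE (hVU ⟨_, hU⟩)) _ _ s).symm

/-! ### Local equations of Cartier divisors -/

lemma mem_unitGerms_iff {x : X} {g : X.functionFieldˣ} :
    g ∈ unitGerms X x ↔
      (g : X.functionField) ∈ (algebraMap (X.presheaf.stalk x) X.functionField).range ∧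
      ((g⁻¹ : X.functionFieldˣ) : X.functionField) ∈
        (algebraMap (X.presheaf.stalk x) X.functionField).range := by
  constructor
  · rintro ⟨u, rfl⟩
    refine ⟨⟨u, rfl⟩, ⟨(u⁻¹ : (X.presheaf.stalk x)ˣ), ?_⟩⟩
    rw [← map_inv]
    rfl
  · rintro ⟨⟨a, ha⟩, ⟨b, hb⟩⟩
    have hab : a * b = 1 := by
      apply algebraMap_stalk_injective x
      rw [map_mul, ha, hb, map_one, Units.mul_inv]
    exact ⟨⟨a, b, hab, by rw [mul_comm, hab]⟩, Units.ext ha⟩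

namespace CartierDivisor

variable {D D' : CartierDivisor X} {x : X} {g g' f : X.functionFieldˣ}

lemma exists_isLocalEq (D : CartierDivisor X) (x : X) :
    ∃ U : X.Opens, x ∈ U ∧ ∃ g : X.functionFieldˣ, ∀ y ∈ U, D.IsLocalEq y g := D.2 x

lemma ext_iff_val : D = D' ↔ ∀ x, D.1 x = D'.1 x :=
  ⟨fun h _ ↦ h ▸ rfl, fun h ↦ Subtype.ext (funext h)⟩

lemma isLocalEq_zero_one : (0 : CartierDivisor X).IsLocalEq x 1 := rfl

lemma IsLocalEq.add (h : D.IsLocalEq x g) (h' : D'.IsLocalEq x g') :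
    (D + D').IsLocalEq x (g * g') :=
  congrArg₂ (fun a b : Additive (X.functionFieldˣ ⧸ unitGerms X x) ↦ a + b) h h'

lemma IsLocalEq.neg (h : D.IsLocalEq x g) : (-D).IsLocalEq x g⁻¹ :=
  congrArg (fun a : Additive (X.functionFieldˣ ⧸ unitGerms X x) ↦ -a) h

lemma isLocalEq_principal : (principal f).IsLocalEq x f := rfl

lemma IsLocalEq.inv_mul_mem (h : D.IsLocalEq x g) (h' : D.IsLocalEq x g') :
    g⁻¹ * g' ∈ unitGerms X x :=
  QuotientGroup.eq.mp (Additive.ofMul.injective (h.symm.trans h'))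

lemma IsLocalEq.of_inv_mul_mem (h : D.IsLocalEq x g) (h' : g⁻¹ * g' ∈ unitGerms X x) :
    D.IsLocalEq x g' :=
  h.trans (congrArg Additive.ofMul (QuotientGroup.eq.mpr h'))

/-- Regularity of `s g` does not depend on the choice of the local equation `g`. -/
lemma IsLocalEq.mul_mem_range (h : D.IsLocalEq x g) (h' : D.IsLocalEq x g') {s : X.functionField}
    (hs : s * g ∈ (algebraMap (X.presheaf.stalk x) X.functionField).range) :
    s * g' ∈ (algebraMap (X.presheaf.stalk x) X.functionField).range := by
  have := mul_mem hs (mem_unitGerms_iff.mp (h.inv_mul_mem h')).1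
  rwa [Units.val_mul, mul_assoc, ← mul_assoc (g : X.functionField),
    Units.mul_inv, one_mul] at this

lemma IsLocalEq.eq_of_eq (h : D.IsLocalEq x g) (h' : D'.IsLocalEq x g) : D.1 x = D'.1 x :=
  h.trans h'.symm

lemma IsEffective.zero : (0 : CartierDivisor X).IsEffective := fun x g hg ↦ by
  simpa using (isLocalEq_zero_one (x := x)).mul_mem_range hg (s := 1) (by simp)

lemma IsEffective.add (hD : D.IsEffective) (hD' : D'.IsEffective) : (D + D').IsEffective := by
  intro x g hg
  obtain ⟨U, hxU, g₁, hg₁⟩ := D.exists_isLocalEq x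
  obtain ⟨V, hxV, g₂, hg₂⟩ := D'.exists_isLocalEq x
  have := mul_mem (hD x g₁ (hg₁ x hxU)) (hD' x g₂ (hg₂ x hxV))
  simpa using ((hg₁ x hxU).add (hg₂ x hxV)).mul_mem_range hg (s := 1) (by simpa using this)

lemma IsEffective.nsmul (hD : D.IsEffective) (n : ℕ) : (n • D).IsEffective := by
  induction n with
  | zero => simpa using IsEffective.zero
  | succ n ih => simpa only [succ_nsmul] using ih.add hD

/-- A local equation of `D` and its inverse, which is an equation of `D' = -D`, are both regular,
so that `D` is trivial. -/
lemma IsEffective.eq_zero_of_add_eq_zero (hD : D.IsEffective) (hD' : D'.IsEffective)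
    (h : D + D' = 0) : D = 0 := by
  refine ext_iff_val.mpr fun x ↦ ?_
  obtain ⟨U, hxU, g, hg⟩ := D.exists_isLocalEq x
  obtain rfl : D' = -D := (neg_eq_of_add_eq_zero_right h).symm
  refine (isLocalEq_zero_one.of_inv_mul_mem ?_ : (0 : CartierDivisor X).IsLocalEq x g).eq_of_eq
    (hg x hxU) |>.symm
  rw [inv_one, one_mul]
  exact mem_unitGerms_iff.mpr ⟨hD x g (hg x hxU), hD' x _ (hg x hxU).neg⟩

lemma principal_mul (f g : X.functionFieldˣ) : principal (f * g) = principal f + principal g := rfl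

lemma principal_one : principal (1 : X.functionFieldˣ) = 0 := rfl

lemma principal_inv (f : X.functionFieldˣ) : principal f⁻¹ = -principal f := rfl

namespace LinearlyEquivalent

variable {D'' : CartierDivisor X}

lemma refl (D : CartierDivisor X) : LinearlyEquivalent D D :=
  ⟨1, by rw [sub_self, principal_one]⟩

lemma symm (h : LinearlyEquivalent D D') : LinearlyEquivalent D' D := by
  obtain ⟨f, hf⟩ := h
  exact ⟨f⁻¹, by rw [principal_inv, ← hf, neg_sub]⟩

lemma trans (h : LinearlyEquivalent D D') (h' : LinearlyEquivalent D' D'') :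
    LinearlyEquivalent D D'' := by
  obtain ⟨f, hf⟩ := h
  obtain ⟨f', hf'⟩ := h'
  exact ⟨f * f', by rw [principal_mul, ← hf, ← hf', sub_add_sub_cancel]⟩

end LinearlyEquivalent

/-- If the ring of global functions is a field, an effective principal divisor is zero: it is the
divisor of a nonzero global function. -/
lemma eq_zero_of_isEffective_principal (hX : IsField Γ(X, ⊤)) (h : (principal f).IsEffective) :
    principal f = 0 := by
  obtain ⟨a, ha⟩ := exists_germ_eq_of_forall_mem_range (U := ⊤) trivial (f : X.functionField)
    fun x _ ↦ h x f isLocalEq_principal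
  have ha0 : a ≠ 0 := by
    rintro rfl
    rw [map_zero] at ha
    exact f.ne_zero ha.symm
  obtain ⟨b, hb⟩ := hX.mul_inv_cancel ha0
  refine ext_iff_val.mpr fun x ↦ ?_
  refine (isLocalEq_zero_one.of_inv_mul_mem ?_ :
    (0 : CartierDivisor X).IsLocalEq x f).eq_of_eq isLocalEq_principal |>.symm
  rw [inv_one, one_mul]
  refine mem_unitGerms_iff.mpr ⟨h x f isLocalEq_principal,
    X.presheaf.germ ⊤ x (Opens.mem_top x) b, ?_⟩
  rw [algebraMap_germ]
  refine Units.eq_inv_of_mul_eq_one_right (u := f) ?_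
  rw [← ha, ← map_mul, mul_comm, hb, map_one]

/-- On a variety without nonconstant global functions, a nonzero effective divisor which is
linearly equivalent to a multiple of an effective divisor `A` is equivalent to a positive
multiple. -/
lemma pos_of_linearlyEquivalent_zsmul (hX : IsField Γ(X, ⊤)) {A : CartierDivisor X}
    (hA : A.IsEffective) (hD : D.IsEffective) (hD0 : D ≠ 0) {n : ℤ}
    (h : LinearlyEquivalent D (n • A)) : 0 < n := by
  by_contra! hn
  obtain ⟨m, rfl⟩ := Int.exists_eq_neg_ofNat hn
  obtain ⟨f, hf⟩ := h
  have hf' : D + m • A = principal f := by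
    rw [← hf, neg_smul, sub_neg_eq_add, natCast_zsmul]
  have heff := hD.add (hA.nsmul m)
  refine hD0 (hD.eq_zero_of_add_eq_zero (hA.nsmul m) ?_)
  rw [hf'] at heff ⊢
  exact eq_zero_of_isEffective_principal hX heff

end CartierDivisor

/-! ### The sheaves `𝒪_X(D)` as line bundles -/

/-- A sheaf of modules with a global section which freely generates the sections over every open
set is isomorphic to the structure sheaf. -/
lemma nonempty_iso_unit {Y : Scheme.{u}} (M : Y.Modules)
    (s : ∀ U : Y.Opens, Γ(M, U))
    (hs : ∀ {U V : Y.Opens} (i : U ⟶ V), M.presheaf.map i.op (s V) = s U)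
    (hs' : ∀ U : Y.Opens, Function.Bijective fun a : Γ(Y, U) ↦ a • s U) :
    Nonempty (structureSheaf Y ≅ M) := by
  let φ : structureSheaf Y ⟶ M := (SheafOfModules.unitHomEquiv (R := Y.ringCatSheaf) M).symm
    (PresheafOfModules.sectionsMk (fun U ↦ s U.unop) fun _ _ i ↦ hs i.unop)
  have : IsIso φ := by
    refine Scheme.Modules.Hom.isIso_iff_isIso_app.mpr fun U ↦ ?_
    rw [ConcreteCategory.isIso_iff_bijective]
    exact hs' U
  exact ⟨asIso φ⟩

lemma nonempty_iso_free {Y : Scheme.{u}} {M : Y.Modules}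
    (e : Nonempty (structureSheaf Y ≅ M)) :
    Nonempty (M ≅
      (SheafOfModules.free (R := Y.ringCatSheaf) (ULift.{u} (Fin 1)) : Y.Modules)) := by
  obtain ⟨e⟩ := e
  exact ⟨e.symm ≪≫ (Limits.coproductUniqueIso
    fun _ : ULift.{u} (Fin 1) ↦ SheafOfModules.unit Y.ringCatSheaf).symm⟩

namespace CartierDivisor

variable {D D' : CartierDivisor X} {x : X} {g g' f : X.functionFieldˣ}

lemma sections_ext {U : X.Opens} {s t : D.sections U} (h : ∀ h, s.1 h = t.1 h) : s = t :=
  Subtype.ext (funext h)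

/-- Multiplication by `f` as a map `𝒪_X(D) → 𝒪_X(D')`, when `D - D' = div f`. -/
def mulHom (f : X.functionFieldˣ) (h : D - D' = principal f) : D.sheaf ⟶ D'.sheaf where
  val := PresheafOfModules.homMk
    { app U := AddCommGrpCat.ofHom
        { toFun s := ⟨fun hη ↦ f * s.1 hη, by
            intro hη x hx g hg
            have hD : D.IsLocalEq x (g * f) := by
              have := hg.add (isLocalEq_principal (f := f) (x := x))
              rwa [← h, add_sub_cancel] at this
            have := s.2 hη x hx _ hD
            rwa [Units.val_mul, mul_comm (g : X.functionField), ← mul_assoc,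
              mul_comm _ (f : X.functionField)] at this⟩
          map_zero' := sections_ext fun hη ↦ mul_zero _
          map_add' s t := sections_ext fun hη ↦ mul_add _ _ _ }
      naturality _ _ _ := rfl }
    (fun U a s ↦ sections_ext fun hη ↦ mul_left_comm _ _ _)

/-- If `D - D' = div f`, multiplication by `f` is an isomorphism `𝒪_X(D) ≅ 𝒪_X(D')`. -/
lemma LinearlyEquivalent.nonempty_iso (h : LinearlyEquivalent D D') :
    Nonempty (D.sheaf ≅ D'.sheaf) := by
  obtain ⟨f, hf⟩ := h
  refine ⟨⟨mulHom f hf, mulHom f⁻¹ (by rw [principal_inv, ← hf, neg_sub]), ?_, ?_⟩⟩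
  · ext U s
    exact sections_ext fun hη ↦ Units.inv_mul_cancel_left _ _
  · ext U s
    exact sections_ext fun hη ↦ Units.mul_inv_cancel_left _ _

/-- If `g` is an equation of `D` on `U`, the section `g⁻¹` of `𝒪_X(D)` over `U`. -/
def gen (g : X.functionFieldˣ) (U : X.Opens) (h : ∀ y ∈ U, D.IsLocalEq y g) : D.sections U :=
  ⟨fun _ ↦ (g⁻¹ : X.functionFieldˣ), fun _ y hy g' hg' ↦
    (h y hy).mul_mem_range hg' (by simp)⟩

/-- Over an open set on which `g` is an equation of `D`, the sheaf `𝒪_X(D)` is free on `g⁻¹`. -/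
lemma bijective_smul_gen (U : X.Opens) (h : ∀ y ∈ U, D.IsLocalEq y g) :
    Function.Bijective fun a : Γ(X, U) ↦ a • D.gen g U h := by
  by_cases hη : genericPoint X ∈ U
  · constructor
    · intro a b hab
      have := congrArg (fun s : D.sections U ↦ s.1 ⟨hη⟩) hab
      exact germ_injective_of_isIntegral X _ hη ((Units.mul_left_inj g⁻¹).mp this)
    · intro s
      obtain ⟨a, ha⟩ := exists_germ_eq_of_forall_mem_range hη (s.1 ⟨hη⟩ * g)
        fun x hx ↦ s.2 hη x hx g (h x hx)
      refine ⟨a, sections_ext fun hη' ↦ ?_⟩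
      refine (congrArg (· * _) ha).trans ?_
      exact Units.mul_inv_cancel_right _ _
  -- An open set without the generic point is empty, and there all modules are zero.
  · have := subsingleton_ratSections hη
    have := subsingleton_sections_of_genericPoint_notMem hη
    have : Subsingleton (D.sections U) := Subtype.val_injective.subsingleton
    exact ⟨fun _ _ _ ↦ Subsingleton.elim _ _, fun _ ↦ ⟨0, Subsingleton.elim _ _⟩⟩

lemma nonempty_structureSheaf_iso_sheaf_zero :
    Nonempty (structureSheaf X ≅ (0 : CartierDivisor X).sheaf) :=
  nonempty_iso_unit _ (fun U ↦ gen 1 U fun _ _ ↦ isLocalEq_zero_one) (fun _ ↦ rfl)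
    fun U ↦ bijective_smul_gen U _

lemma isLineBundle_sheaf (D : CartierDivisor X) : IsLineBundle D.sheaf := by
  intro x
  obtain ⟨U, hxU, g, hg⟩ := D.exists_isLocalEq x
  have hg' (V : U.toScheme.Opens) : ∀ y ∈ U.ι ''ᵁ V, D.IsLocalEq y g := by
    rintro _ ⟨y, -, rfl⟩
    exact hg _ y.2
  refine ⟨U, hxU, nonempty_iso_free (nonempty_iso_unit _
    (fun V ↦ gen g _ (hg' V)) (fun _ ↦ rfl) fun V ↦ ?_)⟩
  exact (bijective_smul_gen (U.ι ''ᵁ V) (hg' V)).comp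
    (ConcreteCategory.bijective_of_isIso (U.ι.appIso V).inv)

end CartierDivisor

/-! ### Tensor products -/

/-- Sheafification inverts locally bijective morphisms of presheaves of modules. -/
lemma isIso_sheafify_map {Y : Scheme.{u}} {P Q : Y.PresheafOfModules} (φ : P ⟶ Q)
    [PresheafOfModules.IsLocallyInjective (Opens.grothendieckTopology Y) φ]
    [PresheafOfModules.IsLocallySurjective (Opens.grothendieckTopology Y) φ] :
    IsIso ((sheafify Y).map φ) := by
  have h := (Opens.grothendieckTopology Y).W_of_isLocallyBijective
    ((PresheafOfModules.toPresheaf Y.ringCatSheaf.obj).map φ)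
  rw [GrothendieckTopology.W_iff] at h
  have : IsIso ((SheafOfModules.toSheaf Y.ringCatSheaf).map ((sheafify Y).map φ)) := h
  have : (SheafOfModules.toSheaf.{u} Y.ringCatSheaf).ReflectsIsomorphisms := inferInstance
  exact isIso_of_reflects_iso (C := SheafOfModules Y.ringCatSheaf) _
    (SheafOfModules.toSheaf Y.ringCatSheaf)

/-- The sheaf associated to the presheaf underlying a sheaf is that sheaf. -/
lemma nonempty_sheafify_iso {Y : Scheme.{u}} (M : Y.Modules) :
    Nonempty ((sheafify Y).obj M.val ≅ M) :=
  have : IsIso (PresheafOfModules.sheafificationAdjunction.{u} (𝟙 Y.ringCatSheaf.obj)).counit :=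
    inferInstance
  ⟨(asIso (PresheafOfModules.sheafificationAdjunction.{u} (𝟙 Y.ringCatSheaf.obj)).counit).app M⟩

lemma nonempty_tensor_congr {Y : Scheme.{u}} {L L' M M' : Y.Modules} (e : L ≅ L') (f : M ≅ M') :
    Nonempty (tensor L M ≅ tensor L' M') :=
  ⟨(sheafify Y).mapIso (MonoidalCategory.tensorIso
    (C := PresheafOfModules.{u} (Y.presheaf ⋙ forget₂ CommRingCat RingCat))
    ((Scheme.Modules.toPresheafOfModules Y).mapIso e)
    ((Scheme.Modules.toPresheafOfModules Y).mapIso f))⟩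

namespace CartierDivisor

variable {D D' : CartierDivisor X} {x : X} {g g' f : X.functionFieldˣ}

lemma mul_mem_sections {U : X.Opens} {s t : RatSections X U} (hs : s ∈ D.sections U)
    (ht : t ∈ D'.sections U) : s * t ∈ (D + D').sections U := by
  intro hη x hx k hk
  obtain ⟨V, hxV, g, hg⟩ := D.exists_isLocalEq x
  obtain ⟨W, hxW, g', hg'⟩ := D'.exists_isLocalEq x
  refine ((hg x hxV).add (hg' x hxW)).mul_mem_range hk ?_
  rw [Units.val_mul]
  exact (mul_mul_mul_comm (s ⟨hη⟩) (t ⟨hη⟩) _ _).symm ▸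
    mul_mem (hs hη x hx g (hg x hxV)) (ht hη x hx g' (hg' x hxW))

variable (D D') in
/-- The product of sections as a bilinear map. -/
def mulBilin (U : X.Opens) :
    D.sections U →ₗ[Γ(X, U)] D'.sections U →ₗ[Γ(X, U)] (D + D').sections U :=
  LinearMap.mk₂ _ (fun s t ↦ ⟨s.1 * t.1, mul_mem_sections s.2 t.2⟩)
    (fun _ _ _ ↦ Subtype.ext (add_mul _ _ _))
    (fun _ _ _ ↦ Subtype.ext (smul_mul_assoc _ _ _))
    (fun _ _ _ ↦ Subtype.ext (mul_add _ _ _))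
    (fun _ _ _ ↦ Subtype.ext (mul_smul_comm _ _ _))

variable (D D') in
/-- The multiplication map from the presheaf tensor product of `𝒪_X(D)` and `𝒪_X(D')`
to `𝒪_X(D + D')`. -/
def mulPresheaf : PresheafOfModules.Monoidal.tensorObj (R := X.presheaf) D.sheaf.val D'.sheaf.val ⟶
    ((D + D').sheaf.val : X.PresheafOfModules) where
  app U := ModuleCat.ofHom (R := Γ(X, U.unop))
    (X := TensorProduct Γ(X, U.unop) (D.sections U.unop) (D'.sections U.unop))
    (Y := (D + D').sections U.unop) (TensorProduct.lift (mulBilin D D' U.unop))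
  naturality {U V} i := by
    refine ModuleCat.MonoidalCategory.tensor_ext (R := Γ(X, U.unop)) (fun s t ↦ ?_)
    rfl

/-- Where both divisors have an equation, multiplication identifies the tensor product of the
modules of sections with the sections of the sum. -/
lemma bijective_lift_mulBilin (U : X.Opens) (h : ∀ y ∈ U, D.IsLocalEq y g)
    (h' : ∀ y ∈ U, D'.IsLocalEq y g') :
    Function.Bijective (TensorProduct.lift (mulBilin D D' U)) := by
  have hsum : ∀ y ∈ U, (D + D').IsLocalEq y (g * g') := fun y hy ↦ (h y hy).add (h' y hy)
  -- Both sides are free of rank one, on `τ = g⁻¹ ⊗ g'⁻¹` and on its image `(g g')⁻¹`.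
  let τ : TensorProduct Γ(X, U) (D.sections U) (D'.sections U) := gen g U h ⊗ₜ gen g' U h'
  have hτ : TensorProduct.lift (mulBilin D D' U) τ = gen (g * g') U hsum :=
    sections_ext fun hη ↦ by
      change ((g⁻¹ : X.functionFieldˣ) : X.functionField) * (g'⁻¹ : X.functionFieldˣ) =
        ((g * g')⁻¹ : X.functionFieldˣ)
      rw [mul_inv, Units.val_mul]
  have hτ' (a : Γ(X, U)) :
      TensorProduct.lift (mulBilin D D' U) (a • τ) = a • gen (g * g') U hsum := by
    rw [map_smul, hτ]
  have surj : Function.Surjective fun a : Γ(X, U) ↦ a • τ := by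
    intro t
    induction t with
    | zero => exact ⟨0, zero_smul _ _⟩
    | add s t hs ht =>
      obtain ⟨a, rfl⟩ := hs
      obtain ⟨b, rfl⟩ := ht
      exact ⟨a + b, add_smul _ _ _⟩
    | tmul s t =>
      obtain ⟨a, rfl⟩ := (bijective_smul_gen U h).2 s
      obtain ⟨b, rfl⟩ := (bijective_smul_gen U h').2 t
      refine ⟨a * b, ?_⟩
      simp only [τ, TensorProduct.smul_tmul', TensorProduct.tmul_smul, smul_smul, mul_comm]
  have hb := bijective_smul_gen U hsum
  have hcomp : Function.Bijective
      (TensorProduct.lift (mulBilin D D' U) ∘ fun a : Γ(X, U) ↦ a • τ) := by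
    rwa [show _ ∘ _ = _ from funext hτ']
  exact (Function.Bijective.of_comp_iff _ ⟨hcomp.1.of_comp, surj⟩).mp hcomp

lemma mulPresheaf_app_map {U V : X.Opensᵒᵖ} (i : U ⟶ V)
    (s : TensorProduct Γ(X, U.unop) (D.sections U.unop) (D'.sections U.unop)) :
    TensorProduct.lift (mulBilin D D' V.unop) ((PresheafOfModules.Monoidal.tensorObj
        (R := X.presheaf) D.sheaf.val D'.sheaf.val).map i s) =
      (D + D').resSections i.unop.le (TensorProduct.lift (mulBilin D D' U.unop) s) :=
  PresheafOfModules.naturality_apply (mulPresheaf D D') i s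

lemma isLocallyInjective_mulPresheaf :
    PresheafOfModules.IsLocallyInjective (Opens.grothendieckTopology X)
    (mulPresheaf D D') where
  equalizerSieve_mem {U} s t hst x hx := by
    obtain ⟨V, hxV, g, hg⟩ := D.exists_isLocalEq x
    obtain ⟨W, hxW, g', hg'⟩ := D'.exists_isLocalEq x
    refine ⟨U.unop ⊓ (V ⊓ W), homOfLE inf_le_left, ?_, hx, hxV, hxW⟩
    refine (bijective_lift_mulBilin (D := D) (D' := D') (U.unop ⊓ (V ⊓ W)) (fun y hy ↦ hg y hy.2.1)
      (fun y hy ↦ hg' y hy.2.2)).1 ?_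
    refine (mulPresheaf_app_map _ s).trans (Eq.trans ?_ (mulPresheaf_app_map _ t).symm)
    exact congrArg ((D + D').resSections _) hst

lemma isLocallySurjective_mulPresheaf :
    PresheafOfModules.IsLocallySurjective (Opens.grothendieckTopology X)
    (mulPresheaf D D') where
  imageSieve_mem {U} s x hx := by
    obtain ⟨V, hxV, g, hg⟩ := D.exists_isLocalEq x
    obtain ⟨W, hxW, g', hg'⟩ := D'.exists_isLocalEq x
    refine ⟨U ⊓ (V ⊓ W), homOfLE inf_le_left, ?_, hx, hxV, hxW⟩
    rw [Presheaf.imageSieve_apply]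
    exact (bijective_lift_mulBilin (D := D) (D' := D') (U ⊓ (V ⊓ W)) (fun y hy ↦ hg y hy.2.1)
      (fun y hy ↦ hg' y hy.2.2)).2 _

lemma nonempty_tensor_iso (D D' : CartierDivisor X) :
    Nonempty (tensor D.sheaf D'.sheaf ≅ (D + D').sheaf) := by
  have := @isIso_sheafify_map X _ _ (mulPresheaf D D') isLocallyInjective_mulPresheaf
    isLocallySurjective_mulPresheaf
  exact ⟨@asIso _ _ _ _ _ this ≪≫ (nonempty_sheafify_iso _).some⟩

/-! ### Isomorphic sheaves come from linearly equivalent divisors -/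

/-- Every morphism `𝒪_X(D) → 𝒪_X(D')` is multiplication by a rational function. -/
lemma exists_forall_app_eq_mul (φ : D.sheaf ⟶ D'.sheaf) :
    ∃ f : X.functionField, ∀ (U : X.Opens) (s : D.sections U) (hη : PLift (genericPoint X ∈ U)),
      (φ.app U s : D'.sections U).1 hη = f * s.1 hη := by
  obtain ⟨U₀, h₀, g, hg⟩ := D.exists_isLocalEq (genericPoint X)
  refine ⟨(φ.app U₀ (gen g U₀ hg) : D'.sections U₀).1 ⟨h₀⟩ * g, fun U s hη ↦ ?_⟩
  -- Restriction does not change rational functions, so it is enough to look at `U ∩ U₀`,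
  -- where `s` is a multiple of the generator `g⁻¹`.
  have res {V W : X.Opens} (i : V ≤ W) (t : D.sections W) :
      (φ.app V (D.resSections i t) : D'.sections V) = D'.resSections i (φ.app W t) :=
    ConcreteCategory.congr_hom (φ.mapPresheaf.naturality (homOfLE i).op) t
  let V := U ⊓ U₀
  have hV : genericPoint X ∈ V := ⟨hη.down, h₀⟩
  obtain ⟨a, ha⟩ := (bijective_smul_gen V fun y hy ↦ hg y hy.2).2 (D.resSections inf_le_left s)
  have h1 : (φ.app U s : D'.sections U).1 hη =
      X.presheaf.germ V (genericPoint X) hV a *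
        (φ.app U₀ (gen g U₀ hg) : D'.sections U₀).1 ⟨h₀⟩ := by
    have := res (inf_le_left : V ≤ U) s
    rw [← ha] at this
    have h2 : (φ.app V (a • gen g V fun y hy ↦ hg y hy.2) : D'.sections V) =
        a • (D'.resSections inf_le_right (φ.app U₀ (gen g U₀ hg)) : D'.sections V) :=
      (Scheme.Modules.Hom.app_smul φ a _).trans
        (congrArg (fun t : D'.sections V ↦ a • t) (res inf_le_right (gen g U₀ hg)))
    exact (congrArg (fun t : D'.sections V ↦ t.1 ⟨hV⟩) (h2.symm.trans this)).symm
  have h2 : s.1 hη = X.presheaf.germ V (genericPoint X) hV a * (g⁻¹ : X.functionFieldˣ) :=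
    (congrArg (fun t : D.sections V ↦ t.1 ⟨hV⟩) ha).symm
  rw [h1, h2]
  calc _ = X.presheaf.germ V (genericPoint X) hV a * _ * (g * (g⁻¹ : X.functionFieldˣ)) := by
        rw [Units.mul_inv, mul_one]
    _ = _ := by ring

/-- A function `f` such that multiplication by `f` maps `𝒪_X(D)` to `𝒪_X(D')` sends the local
generator `g⁻¹` to a multiple of `g'⁻¹`. -/
lemma mul_inv_mul_mem_range {φ : D.sheaf ⟶ D'.sheaf} {f : X.functionField}
    (h : ∀ (U : X.Opens) (s : D.sections U) (hη : PLift (genericPoint X ∈ U)),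
      (φ.app U s : D'.sections U).1 hη = f * s.1 hη)
    (hg : D.IsLocalEq x g) (hg' : D'.IsLocalEq x g') :
    f * (g⁻¹ : X.functionFieldˣ) * g' ∈
      (algebraMap (X.presheaf.stalk x) X.functionField).range := by
  obtain ⟨U, hxU, g₁, hg₁⟩ := D.exists_isLocalEq x
  have := (φ.app U (gen g₁ U hg₁) : D'.sections U).2 (genericPoint_mem hxU) x hxU g' hg'
  rw [h] at this
  have := mul_mem this (mem_unitGerms_iff.mp (hg.inv_mul_mem (hg₁ x hxU))).1
  convert this using 1
  change _ = f * (g₁⁻¹ : X.functionFieldˣ) * g' * ((g⁻¹ * g₁ : X.functionFieldˣ))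
  rw [Units.val_mul]
  calc _ = f * (g⁻¹ : X.functionFieldˣ) * g' * (g₁ * (g₁⁻¹ : X.functionFieldˣ)) := by
        rw [Units.mul_inv, mul_one]
    _ = _ := by ring

/-- An isomorphism `𝒪_X(D) ≅ 𝒪_X(D')` is multiplication by some rational function `f`, and
`D - D' = div f`. -/
lemma linearlyEquivalent_of_iso (e : D.sheaf ≅ D'.sheaf) : LinearlyEquivalent D D' := by
  obtain ⟨a, ha⟩ := exists_forall_app_eq_mul e.hom
  obtain ⟨b, hb⟩ := exists_forall_app_eq_mul e.inv
  have hba : b * a = 1 := by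
    obtain ⟨U, hU, g, hg⟩ := D.exists_isLocalEq (genericPoint X)
    have h1 := hb U (e.hom.app U (gen g U hg)) ⟨hU⟩
    rw [ha] at h1
    have h2 : (e.inv.app U (e.hom.app U (gen g U hg)) : D.sections U) = gen g U hg :=
      ConcreteCategory.congr_hom (congrArg (fun ψ ↦ Scheme.Modules.Hom.app ψ U) e.hom_inv_id) _
    rw [h2, ← mul_assoc] at h1
    exact (mul_eq_right₀ (g⁻¹ : X.functionFieldˣ).ne_zero).mp h1.symm
  let f : X.functionFieldˣ := ⟨a, b, by rw [mul_comm, hba], hba⟩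
  refine ⟨f, ext_iff_val.mpr fun x ↦ ?_⟩
  obtain ⟨U, hxU, g, hg⟩ := D.exists_isLocalEq x
  obtain ⟨V, hxV, g', hg'⟩ := D'.exists_isLocalEq x
  have h := (hg x hxU).add (hg' x hxV).neg
  rw [← sub_eq_add_neg] at h
  refine (h.of_inv_mul_mem (g' := f) (mem_unitGerms_iff.mpr ⟨?_, ?_⟩)).eq_of_eq
    isLocalEq_principal
  · convert mul_inv_mul_mem_range ha (hg x hxU) (hg' x hxV) using 1
    rw [mul_inv, inv_inv, Units.val_mul, Units.val_mul]
    change _ * _ * a = _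
    ring
  · convert mul_inv_mul_mem_range hb (hg' x hxV) (hg x hxU) using 1
    rw [mul_inv, inv_inv, Units.val_mul, Units.val_mul]
    change _ * _ * b = _
    ring

lemma linearlyEquivalent_iff_nonempty_iso :
    LinearlyEquivalent D D' ↔ Nonempty (D.sheaf ≅ D'.sheaf) :=
  ⟨fun h ↦ h.nonempty_iso, fun ⟨e⟩ ↦ linearlyEquivalent_of_iso e⟩

end CartierDivisor

/-! ### Global functions on a projective variety -/

attribute [local instance] MvPolynomial.gradedAlgebra

/-- `Proj` is universally closed over the spectrum of its ring of degree zero, which is the ground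
field in the case of projective space. -/
lemma universallyClosed_of_isProjective {k : Type u} [Field k] {Y : Scheme.{u}}
    {π : Y ⟶ Spec (.of k)} (h : IsProjective π) : UniversallyClosed π := by
  obtain ⟨n, i, hi, rfl⟩ := h
  let 𝒜 := MvPolynomial.homogeneousSubmodule (Fin (n + 1)) k
  have : Function.Surjective (algebraMap k (𝒜 0)) := by
    rintro ⟨p, hp⟩
    rw [MvPolynomial.mem_homogeneousSubmodule,
      ← MvPolynomial.totalDegree_zero_iff_isHomogeneous] at hp
    exact ⟨_, Subtype.ext (MvPolynomial.totalDegree_eq_zero_iff_eq_C.mp hp).symm⟩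
  have : IsClosedImmersion (Spec.map (CommRingCat.ofHom (algebraMap k (𝒜 0)))) :=
    IsClosedImmersion.spec_of_surjective _ this
  have : Algebra.FiniteType (𝒜 0) (MvPolynomial (Fin (n + 1)) k) := by
    have : IsScalarTower k (𝒜 0) (MvPolynomial (Fin (n + 1)) k) :=
      .of_algebraMap_eq (R := k) (S := 𝒜 0) (A := MvPolynomial (Fin (n + 1)) k) fun _ ↦ rfl
    exact .of_restrictScalars_finiteType k _ _
  have : UniversallyClosed (Proj.toSpecZero 𝒜) := inferInstance
  have : UniversallyClosed (projectiveSpaceToSpec k n) := by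
    exact inferInstanceAs (UniversallyClosed (Proj.toSpecZero 𝒜 ≫ Spec.map _))
  infer_instance

/-! ### Determinants along a hierarchical filtration -/

namespace HierarchicalFiltration

open CartierDivisor

variable {r : ℕ} {Λ₀ E : X.Modules}

/-- If `Λ₀ ≅ 𝒪_X(b A)` and the `i`-th increment of the filtration has the sheaf `𝒪_X(nᵢ A)`, then
the determinant of `E` is `𝒪_X((b + ∑ nᵢ) A)`, by induction along the filtration. -/
lemma nonempty_det_top_iso (F : HierarchicalFiltration r Λ₀ E) {A : CartierDivisor X} {b : ℤ}
    (hb : Nonempty (Λ₀ ≅ (b • A).sheaf)) (n : Fin F.length → ℤ)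
    (hn : ∀ i, Nonempty ((F.incr i).sheaf ≅ (n i • A).sheaf)) :
    Nonempty ((det X r).obj E ≅ ((b + ∑ i, n i) • A).sheaf) := by
  have key (m : ℕ) (hm : m < F.length + 1) :
      Nonempty ((det X r).obj (F.step ⟨m, hm⟩ : X.Modules) ≅
        ((b + ∑ i : Fin m, n ⟨i, by omega⟩) • A).sheaf) := by
    induction m with
    | zero =>
      obtain ⟨e⟩ := F.det_zero
      obtain ⟨e'⟩ := hb
      rw [Finset.univ_eq_empty, Finset.sum_empty, add_zero]
      exact ⟨e ≪≫ e'⟩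
    | succ m ih =>
      obtain ⟨e⟩ := ih (by omega)
      obtain ⟨e₁⟩ := F.det_succ ⟨m, by omega⟩
      obtain ⟨e₂⟩ := hn ⟨m, by omega⟩
      obtain ⟨e₃⟩ := nonempty_tensor_congr e e₂
      obtain ⟨e₄⟩ := nonempty_tensor_iso ((b + ∑ i : Fin m, n ⟨i, by omega⟩) • A)
        (n ⟨m, by omega⟩ • A)
      rw [← add_zsmul, add_assoc] at e₄
      rw [Fin.sum_univ_castSucc]
      exact ⟨e₁ ≪≫ e₃ ≪≫ e₄⟩
  obtain ⟨e⟩ := key F.length (by omega)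
  have hE : Nonempty ((F.step ⟨F.length, by omega⟩ : X.Modules) ≅ E) := by
    rw [show F.step ⟨F.length, by omega⟩ = ⊤ from F.step_last]
    exact ⟨asIso (⊤ : Subobject E).arrow⟩
  exact ⟨(det X r).mapIso hE.some.symm ≪≫ e⟩

end HierarchicalFiltration

end HierFilt

end

theorem mainTheorem2 {k : Type u} [Field k] {X : Scheme.{u}} [IsIntegral X]
    (π : X ⟶ Spec (.of k)) [Smooth π] (hπ : HierFilt.IsProjective π)
    (A : HierFilt.CartierDivisor X) (hA_eff : A.IsEffective) (hA_ample : A.IsAmple)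
    (hPic : ∀ L : X.Modules, HierFilt.IsLineBundle L →
      ∃! n : ℤ, Nonempty (L ≅ (n • A).sheaf))
    (r : ℕ) (E : X.Modules) (hE : HierFilt.IsVectorBundle r E)
    (Λ₀ : X.Modules) (hΛ₀ : HierFilt.IsLineBundle Λ₀)
    (d d₀ : ℤ) (hd : Nonempty ((HierFilt.det X r).obj E ≅ (d • A).sheaf))
    (hd₀ : Nonempty (Λ₀ ≅ (d₀ • A).sheaf)) :
    (∀ F : HierFilt.HierarchicalFiltration r Λ₀ E, (F.length : ℤ) ≤ d - d₀) ∧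
    HierFilt.hierarchicalDepth r Λ₀ E ≤ (((d - d₀ : ℤ) : ℝ) : EReal) ∧
    (Nonempty (Λ₀ ≅ HierFilt.structureSheaf X) →
      HierFilt.hierarchicalDepth r Λ₀ E ≤ ((d : ℝ) : EReal)) ∧
    (∀ F : HierFilt.HierarchicalFiltration r Λ₀ E,
      (F.length : ℤ) = d - d₀ ↔ ∀ i, (F.incr i).LinearlyEquivalent A) ∧
    (HierFilt.hierarchicalDepth r Λ₀ E = (((d - d₀ : ℤ) : ℝ) : EReal) ↔
      ∃ F : HierFilt.HierarchicalFiltration r Λ₀ E,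
        ∀ i, (F.incr i).LinearlyEquivalent A) := by
  open HierFilt CartierDivisor in
  have : UniversallyClosed π := universallyClosed_of_isProjective hπ
  have hX : IsField Γ(X, ⊤) := isField_of_universallyClosed k π
  have inj {m n : ℤ} (h : LinearlyEquivalent (m • A) (n • A)) : m = n :=
    (hPic _ (isLineBundle_sheaf (m • A))).unique (LinearlyEquivalent.refl _).nonempty_iso
      h.nonempty_iso
  -- The degrees of the increments are positive and add up to `d - d₀`.
  have degrees (F : HierarchicalFiltration r Λ₀ E) : ∃ n : Fin F.length → ℤ,
      (∀ i, LinearlyEquivalent (F.incr i) (n i • A)) ∧ (∀ i, 1 ≤ n i) ∧ ∑ i, n i = d - d₀ := by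
    choose n hn _ using fun i ↦ hPic _ (isLineBundle_sheaf (F.incr i))
    have hn' (i) : LinearlyEquivalent (F.incr i) (n i • A) :=
      linearlyEquivalent_iff_nonempty_iso.mpr (hn i)
    refine ⟨n, hn', fun i ↦ pos_of_linearlyEquivalent_zsmul hX hA_eff (F.incr_effective i)
      (F.incr_ne_zero i) (hn' i), ?_⟩
    obtain ⟨e⟩ := F.nonempty_det_top_iso hd₀ n hn
    obtain ⟨e'⟩ := hd
    have := inj (linearlyEquivalent_of_iso (e.symm ≪≫ e'))
    omega
  have le (F : HierarchicalFiltration r Λ₀ E) : (F.length : ℤ) ≤ d - d₀ := by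
    obtain ⟨n, -, hn, hsum⟩ := degrees F
    rw [← hsum]
    simpa using Finset.sum_le_sum fun i (_ : i ∈ Finset.univ) ↦ hn i
  have eq_iff (F : HierarchicalFiltration r Λ₀ E) :
      (F.length : ℤ) = d - d₀ ↔ ∀ i, (F.incr i).LinearlyEquivalent A := by
    obtain ⟨n, hlin, hn, hsum⟩ := degrees F
    have h1 : (F.length : ℤ) = d - d₀ ↔ ∀ i, 1 = n i := by
      have := Finset.sum_eq_sum_iff_of_le fun i (_ : i ∈ Finset.univ) ↦ hn i
      rw [hsum] at this
      simpa using this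
    rw [h1]
    refine forall_congr' fun i ↦ ⟨fun h ↦ ?_, fun h ↦ inj ?_⟩
    · simpa [← h] using hlin i
    · rw [one_zsmul]
      exact h.symm.trans (hlin i)
  have depth_le : hierarchicalDepth r Λ₀ E ≤ (((d - d₀ : ℤ) : ℝ) : EReal) :=
    iSup_le fun F ↦ EReal.coe_le_coe_iff.mpr (by exact_mod_cast le F)
  refine ⟨le, depth_le, ?_, eq_iff, ?_, ?_⟩
  · rintro ⟨e⟩
    have h0 : d₀ = 0 := (hPic _ hΛ₀).unique hd₀ (by
      rw [zero_zsmul]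
      exact ⟨e ≪≫ nonempty_structureSheaf_iso_sheaf_zero.some⟩)
    simpa [h0] using depth_le
  · intro h
    have hlt : (((d - d₀ - 1 : ℤ) : ℝ) : EReal) < hierarchicalDepth r Λ₀ E := by
      rw [h, EReal.coe_lt_coe_iff]
      exact_mod_cast sub_one_lt (d - d₀)
    -- Lengths are integers, so a length exceeding `d - d₀ - 1` equals `d - d₀`.
    obtain ⟨F, hF⟩ := lt_iSup_iff.mp hlt
    refine ⟨F, (eq_iff F).mp ?_⟩
    have hF' : d - d₀ - 1 < (F.length : ℤ) := by
      exact_mod_cast EReal.coe_lt_coe_iff.mp hF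
    have := le F
    omega
  · rintro ⟨F, hF⟩
    refine le_antisymm depth_le ?_
    rw [← (eq_iff F).mpr hF]
    exact_mod_cast le_iSup (fun F : HierarchicalFiltration r Λ₀ E ↦ ((F.length : ℝ) : EReal)) F
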